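/- Let $\mathfrak S_n$ be the set of permutations of $\{1,\dots,n\}$. For $\pi\in\mathfrak S_n$ let $\mathrm{fix}(\pi)=\#\{i:\pi(i)=i\}$, $\mathrm{exc}(\pi)=\#\{i:\pi(i)>i\}$, let $\mathrm{cda}(\pi)=\#\{v:\pi^{-1}(v)<v<\pi(v)\}$ be the number of cycle double ascents, and let $\mathrm{lpk}(\pi)=\#\{1\le i\le n-1:\pi(i-1)<\pi(i)>\pi(i+1)\}$, with $\pi(0)=0$, be the number of left peaks. Let $\mathcal C_n=\{\pi\in\mathfrak S_n:\mathrm{cda}(\pi)=0\}$, and let $\mathcal{SS}_n$ be the set of simsun permutations of the second kind, i.e. of those $\pi\in\mathfrak S_n$ such that for every $0\le k\le n$ the permutation obtained by deleting the $k$ largest letters from the cycle notation of $\pi$ has no cycle double ascents. Put $$b_{n,i,j}=\#\{\pi\in\mathcal C_n:\mathrm{fix}(\pi)=i,\ \mathrm{exc}(\pi)=j\},\qquad \gamma_{n,i,j}=\#\{\pi\in\mathcal{SS}_n:\mathrm{fix}(\pi)=i,\ \mathrm{exc}(\pi)=j\},$$ $$Q(n,i)=\#\{\pi\in\mathfrak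 S_n:\mathrm{lpk}(\pi)=i\},$$ and consider the formal power series in $z$ $$C(s,x;z)=\sum_{n\ge0}\sum_{i=0}^n\sum_{j=0}^{\lfloor (n-i)/2\rfloor}b_{n,i,j}s^ix^j\frac{z^n}{n!},\qquad M(s,x;z)=\sum_{n\ge0}\sum_{i=0}^n\sum_{j=0}^{\lfloor (n-i)/2\rfloor}\gamma_{n,i,j}s^ix^j\frac{z^n}{n!},$$ $$b(x;z)=\sum_{n\ge0}\sum_{i=0}^{\lfloor n/2\rfloor}4^iQ(n,i)x^i\frac{z^n}{n!},$$ where $s,x$ are indeterminates or, more generally, elements of any commutative $\mathbb Q$-algebra. Then $$C(1/2,x;2z)=b(x;z),\qquad C(s,x;z)^2=e^{sz}M(s,2x;z),$$ and, for every $n\ge0$, $$\sum_{\pi\in\mathcal C_n}2^{\,n-\mathrm{fix}(\pi)}x^{\mathrm{exc}(\pi)}=\sum_{\pi\in\mathfrak S_n}(4x)^{\mathrm{lpk}(\pi)}.$$ -/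

import Mathlib

namespace PermStat

/-- Number of fixed points. The letters `1, …, n` are represented by `0, …, n - 1 : Fin n`. -/
def fixCount {n : ℕ} (π : Equiv.Perm (Fin n)) : ℕ :=
  (Finset.univ.filter fun i : Fin n => π i = i).card

/-- Number of excedances. -/
def exc {n : ℕ} (π : Equiv.Perm (Fin n)) : ℕ :=
  (Finset.univ.filter fun i : Fin n => i < π i).card

/-- Number of cycle double ascents, i.e. of values `v` with `π⁻¹ v < v < π v`. -/
def cda {n : ℕ} (π : Equiv.Perm (Fin n)) : ℕ :=
  (Finset.univ.filter fun v : Fin n => π.symm v < v ∧ v < π v).card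

/-- The one-line notation `π(1) ⋯ π(n)` with the letters `1, …, n`, at the positions `1, …, n`;
the entry at every other position is `0`, in particular `π(0) = 0`. -/
def entry {n : ℕ} (π : Equiv.Perm (Fin n)) (k : ℕ) : ℕ :=
  if h : 1 ≤ k ∧ k ≤ n then (π ⟨k - 1, by omega⟩ : ℕ) + 1 else 0

/-- Number of left peaks: indices `i ∈ {1, …, n - 1}` with `π(i-1) < π(i) > π(i+1)`, `π(0) = 0`. -/
def lpk {n : ℕ} (π : Equiv.Perm (Fin n)) : ℕ :=
  ((Finset.Icc 1 (n - 1)).filter fun i : ℕ =>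
    entry π (i - 1) < entry π i ∧ entry π (i + 1) < entry π i).card

/-- Delete the largest letter from the cycle notation of a permutation of `n + 1` letters: the
letter that was mapped to the largest one is now mapped to the image of the largest one, and all
other images are unchanged. -/
def removeLargest {n : ℕ} (π : Equiv.Perm (Fin (n + 1))) : Equiv.Perm (Fin n) :=
  Equiv.removeNone ((finSuccEquivLast.symm.trans π).trans finSuccEquivLast)

/-- The simsun permutations of the second kind: neither the permutation itself nor any of the
permutations obtained from it by successively removing the largest letter has a cycle double
ascent. -/
def simsun : (n : ℕ) → Finset (Equiv.Perm (Fin n))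
  | 0 => Finset.univ
  | n + 1 => Finset.univ.filter fun π => cda π = 0 ∧ removeLargest π ∈ simsun n

/-- The set of permutations of `n` letters without cycle double ascents. -/
def noCda (n : ℕ) : Finset (Equiv.Perm (Fin n)) :=
  Finset.univ.filter fun π => cda π = 0

/-- `γ_{n,i,j}`: the number of simsun permutations of the second kind of `n` letters with `i` fixed
points and `j` excedances. -/
def gammaNum (n i j : ℕ) : ℕ :=
  ((simsun n).filter fun π => fixCount π = i ∧ exc π = j).card

/-- `b_{n,i,j}`: the number of permutations of `n` letters without cycle double ascents, with `i`
fixed points and `j` excedances. -/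
def bNum (n i j : ℕ) : ℕ :=
  ((noCda n).filter fun π => fixCount π = i ∧ exc π = j).card

/-- `Q(n, i)`: the number of permutations of `n` letters with `i` left peaks. -/
def lpkNum (n i : ℕ) : ℕ :=
  (Finset.univ.filter fun π : Equiv.Perm (Fin n) => lpk π = i).card

section Series

variable {R : Type*} [CommRing R] [Algebra ℚ R]

/-- The exponential generating function `∑ a_n z^n / n!`, as a formal power series in `z`. -/
noncomputable def egf (a : ℕ → R) : PowerSeries R :=
  PowerSeries.mk fun n => algebraMap ℚ R (1 / (n.factorial : ℚ)) * a n

/-- `C(s, x; z)`. -/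
noncomputable def cSeries (s x : R) : PowerSeries R :=
  egf fun n => ∑ i ∈ Finset.range (n + 1), ∑ j ∈ Finset.range ((n - i) / 2 + 1),
    (bNum n i j : R) * s ^ i * x ^ j

/-- `M(s, x; z)`. -/
noncomputable def mSeries (s x : R) : PowerSeries R :=
  egf fun n => ∑ i ∈ Finset.range (n + 1), ∑ j ∈ Finset.range ((n - i) / 2 + 1),
    (gammaNum n i j : R) * s ^ i * x ^ j

/-- `b(x; z)`, the exponential generating function of `b_n(x) = ∑ 4^i Q(n, i) x^i`. -/
noncomputable def bSeries (x : R) : PowerSeries R :=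
  egf fun n => ∑ i ∈ Finset.range (n / 2 + 1), 4 ^ i * (lpkNum n i : R) * x ^ i

end Series

end PermStat

/-! Inserting a largest letter acts on suitable weights as a derivation `D`. In a cycle, the new
letter becomes a cycle peak and changes only the type of the larger of its two neighbours: a fixed
point becomes a valley, a double ascent or descent becomes a valley, and a peak becomes a double
ascent or a double descent depending on the side of insertion. Hence `D s = D a = D d = p` and `D p
= p * (a + d)`. With `D e = e * s` accounting for insertion as a fixed point, `D^n e` is `e` times
the total weight of the permutations of `n` letters.

These rules are realised by `D = d/dz` on power series. Let `y' = x + y + y²`, `y(0) = 0`. The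
weights `s + y`, `x + y + y²`, `y`, `1 + y` take the values `s`, `x`, `0`, `1` at `z = 0`, so double
ascents are excluded and `C' = C (s + y)`. For simsun permutations double ascents are forbidden at
every stage, i.e. `a = 0` throughout; `s + 2y`, `2(x + y + y²)`, `1 + 2y` obey these rules, so `M(s,
2x)` has logarithmic derivative `s + 2y`. As `C²` has `2s + 2y`, the quotient is `e^{sz}`.

For left peaks, insertion into one-line notation gives `D p = 2 p w`, `D w = p`, realised by `w = 1
+ 2 y(2z)`, which is also the logarithmic derivative of `C(1/2, x; 2z)`. The last identity compares
coefficients. -/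

/-! ### Formal differential equations and derivations -/

open PowerSeries in
/-- A formal ordinary differential equation `f' = Φ f` whose right-hand side is causal (the
coefficients of `Φ f` up to degree `n` only depend on those of `f` up to degree `n`) has a solution
with any given constant coefficient. -/
theorem PowerSeries.exists_derivative_eq {R : Type*} [CommRing R] [Algebra ℚ R]
    (Φ : R⟦X⟧ → R⟦X⟧)
    (hΦ : ∀ f g n, (∀ m ≤ n, coeff m f = coeff m g) → coeff n (Φ f) = coeff n (Φ g)) (c : R) :
    ∃ f : R⟦X⟧, constantCoeff f = c ∧ derivative R f = Φ f := by
  -- Picard iteration: `F` integrates `Φ f` formally, with constant term `c`. Each application makes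
  -- one more coefficient final, so the iterates of `0` converge to a fixed point.
  let F : R⟦X⟧ → R⟦X⟧ := fun f =>
    mk fun n => n.casesOn c fun k => algebraMap ℚ R (1 / ((k : ℚ) + 1)) * coeff k (Φ f)
  have hF0 : ∀ f, coeff 0 (F f) = c := fun f => by simp [F]
  have hFs : ∀ f k, coeff (k + 1) (F f) = algebraMap ℚ R (1 / ((k : ℚ) + 1)) * coeff k (Φ f) :=
    fun f k => by simp only [F, coeff_mk]
  have agree : ∀ f g n, (∀ m < n, coeff m f = coeff m g) →
      ∀ m < n + 1, coeff m (F f) = coeff m (F g) := by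
    intro f g n h m hm
    rcases m with _ | m
    · rw [hF0, hF0]
    · rw [hFs, hFs, hΦ f g m fun k hk => h k (by omega)]
  have stable : ∀ k j, ∀ m < k, coeff m (F^[k + j] 0) = coeff m (F^[k] 0) := by
    intro k
    induction k with
    | zero => intro j m hm; omega
    | succ k ih =>
      intro j
      rw [Nat.succ_add, Function.iterate_succ_apply', Function.iterate_succ_apply']
      exact agree _ _ _ (ih j)
  let f : R⟦X⟧ := mk fun m => coeff m (F^[m + 1] 0)
  have hf : ∀ k, ∀ m < k, coeff m f = coeff m (F^[k] 0) := by
    intro k m hm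
    obtain ⟨j, rfl⟩ := Nat.exists_eq_add_of_lt hm
    have := stable (m + 1) j m (by omega)
    rw [show m + 1 + j = m + j + 1 by ring] at this
    simp only [f, coeff_mk, this]
  have hfix : F f = f := by
    ext m
    rw [hf (m + 2) m (by omega), Function.iterate_succ_apply']
    exact agree _ _ _ (hf (m + 1)) m (by omega)
  refine ⟨f, ?_, ?_⟩
  · rw [← coeff_zero_eq_constantCoeff_apply, ← hfix, hF0]
  · ext k
    rw [coeff_derivative, ← hfix, hFs, hfix, mul_right_comm]
    have : algebraMap ℚ R (1 / ((k : ℚ) + 1)) * ((k : R) + 1) = 1 := by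
      have h : ((k : R) + 1) = algebraMap ℚ R ((k : ℚ) + 1) := by simp
      rw [h, ← map_mul, one_div_mul_cancel (by positivity), map_one]
    rw [this, one_mul]

theorem PowerSeries.coeff_mul_congr {R : Type*} [CommRing R] {f g f' g' : PowerSeries R} {n : ℕ}
    (hf : ∀ m ≤ n, coeff m f = coeff m f') (hg : ∀ m ≤ n, coeff m g = coeff m g') :
    coeff n (f * g) = coeff n (f' * g') := by
  rw [coeff_mul, coeff_mul]
  refine Finset.sum_congr rfl fun p hp => ?_
  have := Finset.HasAntidiagonal.mem_antidiagonal.1 hp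
  rw [hf _ (by omega), hg _ (by omega)]

theorem PowerSeries.derivative_rescale {R : Type*} [CommRing R] (a : R) (f : PowerSeries R) :
    derivative R (rescale a f) = C a * rescale a (derivative R f) := by
  ext n
  simp only [coeff_derivative, coeff_rescale, coeff_C_mul]
  ring

theorem Derivation.map_finset_prod {k A ι : Type*} [CommRing k] [CommRing A] [Algebra k A]
    [DecidableEq ι] (D : Derivation k A A) (t : Finset ι) (f : ι → A) :
    D (∏ i ∈ t, f i) = ∑ i ∈ t, D (f i) * ∏ j ∈ t.erase i, f j := by
  induction t using Finset.induction_on with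
  | empty => simp
  | insert a t ha ih =>
    rw [Finset.prod_insert ha, Derivation.leibniz, Finset.sum_insert ha, ih,
      Finset.erase_insert ha, smul_eq_mul, smul_eq_mul, Finset.mul_sum, add_comm, mul_comm]
    congr 1
    refine Finset.sum_congr rfl fun i hi => ?_
    rw [Finset.erase_insert_of_ne (by rintro rfl; exact ha hi),
      Finset.prod_insert (fun h => ha (Finset.mem_of_mem_erase h))]
    ring

/-! ### Insertion into the cycle notation -/

namespace PermStat

/-- Insert a new largest letter into the cycle notation of a permutation of `n` letters: as a fixed
point for `none`, and immediately before the letter `b` for `some b`. -/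
def insertLargest {n : ℕ} (π : Equiv.Perm (Fin n)) (o : Option (Fin n)) :
    Equiv.Perm (Fin (n + 1)) :=
  (finSuccEquivLast.trans (Equiv.Perm.decomposeOption.symm (o, π))).trans finSuccEquivLast.symm

/-- Every permutation of `n + 1` letters arises by exactly one insertion of the largest letter. -/
def insertLargestEquiv (n : ℕ) :
    Option (Fin n) × Equiv.Perm (Fin n) ≃ Equiv.Perm (Fin (n + 1)) :=
  Equiv.Perm.decomposeOption.symm.trans finSuccEquivLast.symm.permCongr

theorem insertLargestEquiv_apply {n : ℕ} (q : Option (Fin n) × Equiv.Perm (Fin n)) :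
    insertLargestEquiv n q = insertLargest q.2 q.1 := by
  ext v
  rfl

theorem removeLargest_insertLargest {n : ℕ} (π : Equiv.Perm (Fin n)) (o : Option (Fin n)) :
    removeLargest (insertLargest π o) = π := by
  have h : (finSuccEquivLast.symm.trans (insertLargest π o)).trans finSuccEquivLast =
      Equiv.Perm.decomposeOption.symm (o, π) := by
    ext1 v
    simp [insertLargest]
  rw [removeLargest, h]
  exact congrArg Prod.snd (Equiv.Perm.decomposeOption.apply_symm_apply (o, π))

theorem insertLargest_none_castSucc {n : ℕ} (π : Equiv.Perm (Fin n)) (v : Fin n) :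
    insertLargest π none v.castSucc = (π v).castSucc := by
  simp [insertLargest]

theorem insertLargest_none_last {n : ℕ} (π : Equiv.Perm (Fin n)) :
    insertLargest π none (Fin.last n) = Fin.last n := by
  simp [insertLargest]

theorem insertLargest_none_symm_castSucc {n : ℕ} (π : Equiv.Perm (Fin n)) (v : Fin n) :
    (insertLargest π none).symm v.castSucc = (π.symm v).castSucc := by
  rw [Equiv.symm_apply_eq, insertLargest_none_castSucc, π.apply_symm_apply]

theorem insertLargest_some_castSucc {n : ℕ} (π : Equiv.Perm (Fin n)) (b v : Fin n) :
    insertLargest π (some b) v.castSucc = if π v = b then Fin.last n else (π v).castSucc := by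
  split_ifs with h
  · simp [insertLargest, h]
  · simp [insertLargest, Equiv.swap_apply_of_ne_of_ne, h]

theorem insertLargest_some_last {n : ℕ} (π : Equiv.Perm (Fin n)) (b : Fin n) :
    insertLargest π (some b) (Fin.last n) = b.castSucc := by
  simp [insertLargest]

theorem insertLargest_some_symm_castSucc {n : ℕ} (π : Equiv.Perm (Fin n)) (b v : Fin n) :
    (insertLargest π (some b)).symm v.castSucc =
      if v = b then Fin.last n else (π.symm v).castSucc := by
  rw [Equiv.symm_apply_eq]
  split_ifs with h
  · rw [insertLargest_some_last, h]
  · rw [insertLargest_some_castSucc, π.apply_symm_apply, if_neg h]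

theorem insertLargest_some_symm_last {n : ℕ} (π : Equiv.Perm (Fin n)) (b : Fin n) :
    (insertLargest π (some b)).symm (Fin.last n) = (π.symm b).castSucc := by
  rw [Equiv.symm_apply_eq, insertLargest_some_castSucc, π.apply_symm_apply, if_pos rfl]

section Weight

variable {A : Type*} [CommRing A]

/-- The weight of the letter `v` with predecessor `u` and successor `w` in its cycle: `s` for a
fixed point, `p` for a cycle peak, `a` for a cycle double ascent, `d` for a cycle double descent,
`1` for a cycle valley. -/
def letterWeight (s p a d : A) {α : Type*} [LinearOrder α] (u v w : α) : A :=
  if w = v then s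
  else if u < v then if w < v then p else a
  else if w < v then d else 1

/-- The product of the weights of all letters of a permutation. -/
def cycleWeight (s p a d : A) {n : ℕ} (π : Equiv.Perm (Fin n)) : A :=
  ∏ v, letterWeight s p a d (π.symm v) v (π v)

theorem cycleWeight_insertLargest_none (s p a d : A) {n : ℕ} (π : Equiv.Perm (Fin n)) :
    cycleWeight s p a d (insertLargest π none) = s * cycleWeight s p a d π := by
  rw [cycleWeight, Fin.prod_univ_castSucc, mul_comm]
  congr 1
  · simp [letterWeight, insertLargest_none_last]
  · refine Finset.prod_congr rfl fun v _ => ?_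
    simp [letterWeight, insertLargest_none_castSucc, insertLargest_none_symm_castSucc]

theorem cycleWeight_insertLargest_some (s p a d : A) {n : ℕ} (π : Equiv.Perm (Fin n))
    (b c : Fin n) (hc : c = if π.symm b ≤ b then b else π.symm b) :
    cycleWeight s p a d (insertLargest π (some b)) =
      p * (letterWeight s p a d ((insertLargest π (some b)).symm c.castSucc) c.castSucc
        (insertLargest π (some b) c.castSucc) *
        ∏ v ∈ Finset.univ.erase c, letterWeight s p a d (π.symm v) v (π v)) := by
  rw [cycleWeight, Fin.prod_univ_castSucc, mul_comm,
    ← Finset.mul_prod_erase _ _ (Finset.mem_univ c)]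
  congr 1
  · rw [insertLargest_some_last, insertLargest_some_symm_last, letterWeight,
      if_neg (Fin.castSucc_lt_last b).ne, if_pos (Fin.castSucc_lt_last _),
      if_pos (Fin.castSucc_lt_last _)]
  · congr 1
    refine Finset.prod_congr rfl fun v hv => ?_
    have hvc : v ≠ c := Finset.ne_of_mem_erase hv
    rw [insertLargest_some_castSucc, insertLargest_some_symm_castSucc]
    have hlast := Fin.castSucc_lt_last v
    rcases eq_or_ne v b with rfl | hvb
    · have hlt : v < π.symm v := by
        by_contra h
        exact hvc (by rw [hc, if_pos (not_lt.1 h)])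
      have hne : π v ≠ v := fun h => by
        rw [(Equiv.symm_apply_eq _).2 h.symm] at hlt
        exact lt_irrefl _ hlt
      simp [letterWeight, hne, hlt.not_gt, hlast.not_gt]
    · by_cases hvp : π v = b
      · have hvb' : π.symm b = v := (Equiv.symm_apply_eq _).2 hvp.symm
        have hlt : v < b := by
          by_contra h
          refine hvc ?_
          rw [hc, hvb', if_neg]
          exact fun h' => hvb (le_antisymm h' (not_lt.1 h))
        simp [letterWeight, hvb, hvp, hlt.not_gt, hlast.not_gt, hlast.ne', hvb.symm]
      · simp [letterWeight, hvb, hvp]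

/-- Differentiating the weight of a permutation amounts to inserting the largest letter into its
cycles in all possible ways. -/
theorem derivation_cycleWeight {k : Type*} [CommRing k] [Algebra k A] (D : Derivation k A A)
    {s p a d : A} (hs : D s = p) (hp : D p = p * (a + d)) (hd : D d = p) {n : ℕ}
    (π : Equiv.Perm (Fin n)) (ha : D a = p ∨ cda π = 0) :
    D (cycleWeight s p a d π) = ∑ b, cycleWeight s p a d (insertLargest π (some b)) := by
  let E : Fin n → A := fun c =>
    ∏ v ∈ Finset.univ.erase c, letterWeight s p a d (π.symm v) v (π v)
  -- The insertions that alter the weight of `v`: just before `v` when its predecessor is smaller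
  -- (`T₁`), just after `v` when its successor is smaller (`T₂`), next to a fixed point (`T₃`).
  let T₁ : Fin n → A := fun v =>
    if π.symm v < v then p * ((if π v < v then d else 1) * E v) else 0
  let T₂ : Fin n → A := fun v =>
    if π v < v then p * ((if π.symm v < v then a else 1) * E v) else 0
  let T₃ : Fin n → A := fun v => if π v = v then p * E v else 0
  have fix : ∀ v, π.symm v = v ↔ π v = v := fun v => by
    rw [Equiv.symm_apply_eq, eq_comm]
  have lhs : ∀ v, D (letterWeight s p a d (π.symm v) v (π v)) * E v = T₁ v + T₂ v + T₃ v := by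
    intro v
    by_cases h : π v = v
    · have h' := (fix v).2 h
      simp [letterWeight, T₁, T₂, T₃, h, h', hs]
    by_cases h₁ : π.symm v < v <;> by_cases h₂ : π v < v
    · simp only [letterWeight, T₁, T₂, T₃, h, h₁, h₂, if_true, if_false, hp]
      ring
    -- Only a double ascent of `π` requires the rule for `a`; this is what permits `a = 0` for
    -- simsun permutations.
    · have hda : D a = p := by
        refine ha.resolve_right fun h0 => ?_
        have := Finset.card_eq_zero.1 h0
        have hm : v ∈ Finset.univ.filter fun v : Fin n => π.symm v < v ∧ v < π v :=
          Finset.mem_filter.2 ⟨Finset.mem_univ v, h₁, lt_of_le_of_ne (not_lt.1 h₂) (Ne.symm h)⟩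
        rw [this] at hm
        simp at hm
      simp [letterWeight, T₁, T₂, T₃, h, h₁, h₂, hda]
    · simp [letterWeight, T₁, T₂, T₃, h, h₁, h₂, hd]
    · simp [letterWeight, T₁, T₂, T₃, h, h₁, h₂]
  have rhs : ∀ b, cycleWeight s p a d (insertLargest π (some b)) =
      T₁ b + T₂ (π.symm b) + T₃ b := by
    intro b
    rw [cycleWeight_insertLargest_some s p a d π b _ rfl]
    have hlast : ∀ v : Fin n, ¬ Fin.last n < v.castSucc := fun v =>
      (Fin.castSucc_lt_last v).not_gt
    have hlast' : ∀ v : Fin n, Fin.last n ≠ v.castSucc := fun v => (Fin.castSucc_lt_last v).ne'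
    rcases lt_trichotomy (π.symm b) b with h | h | h
    · have hb : π b ≠ b := fun h' => h.ne ((fix b).2 h')
      simp only [h.le, if_true]
      rw [insertLargest_some_castSucc, insertLargest_some_symm_castSucc]
      change p * (_ * E _) = _
      simp [letterWeight, T₁, T₂, T₃, h, hb, h.not_gt, hlast]
    · have hb : π b = b := (fix b).1 h
      simp only [h.le, if_true]
      rw [insertLargest_some_castSucc, insertLargest_some_symm_castSucc]
      change p * (_ * E _) = _
      simp [letterWeight, T₁, T₂, T₃, h, hb, hlast, hlast']
    · have hb : π b ≠ b := fun h' => h.ne' ((fix b).2 h')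
      simp only [h.not_ge, if_false]
      rw [insertLargest_some_castSucc, insertLargest_some_symm_castSucc]
      change p * (_ * E _) = _
      simp [letterWeight, T₁, T₂, T₃, h, hb, h.not_gt, h.ne', hlast, hlast']
  rw [cycleWeight, Derivation.map_finset_prod, Finset.sum_congr rfl fun v _ => lhs v,
    Finset.sum_congr rfl fun b _ => rhs b]
  simp only [Finset.sum_add_distrib]
  -- The slot just after `v` is indexed by the letter `b = π v` that follows it.
  rw [Equiv.sum_comp π.symm T₂]

theorem sum_perm_succ {n : ℕ} (f : Equiv.Perm (Fin (n + 1)) → A) :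
    ∑ σ, f σ = ∑ π : Equiv.Perm (Fin n), (f (insertLargest π none) +
      ∑ b, f (insertLargest π (some b))) := by
  rw [← (insertLargestEquiv n).sum_comp, Fintype.sum_prod_type_right]
  refine Finset.sum_congr rfl fun π _ => ?_
  simp only [insertLargestEquiv_apply, Fintype.sum_option]

theorem cycleWeight_eq_zero (s p d : A) {n : ℕ} {π : Equiv.Perm (Fin n)} (h : cda π ≠ 0) :
    cycleWeight s p 0 d π = 0 := by
  obtain ⟨v, hv⟩ := Finset.card_ne_zero.1 h
  obtain ⟨-, h₁, h₂⟩ := Finset.mem_filter.1 hv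
  exact Finset.prod_eq_zero (Finset.mem_univ v) (by simp [letterWeight, h₁, h₂.ne', h₂.not_gt])

theorem cda_eq_zero_of_mem_simsun {n : ℕ} {π : Equiv.Perm (Fin n)} (h : π ∈ simsun n) :
    cda π = 0 := by
  cases n with
  | zero => simp [cda]
  | succ n => exact (Finset.mem_filter.1 h).2.1

/-- With `a = 0` an insertion creating a double ascent has weight zero, so all insertions into
simsun permutations may be summed. -/
theorem sum_simsun_succ (s p d : A) (n : ℕ) :
    ∑ σ ∈ simsun (n + 1), cycleWeight s p 0 d σ =
      ∑ π ∈ simsun n, (cycleWeight s p 0 d (insertLargest π none) +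
        ∑ b, cycleWeight s p 0 d (insertLargest π (some b))) := by
  have h : ∀ σ : Equiv.Perm (Fin (n + 1)),
      (if cda σ = 0 ∧ removeLargest σ ∈ simsun n then cycleWeight s p 0 d σ else 0) =
        if removeLargest σ ∈ simsun n then cycleWeight s p 0 d σ else 0 := by
    intro σ
    by_cases hσ : cda σ = 0
    · simp [hσ]
    · simp [hσ, cycleWeight_eq_zero s p d hσ]
  rw [simsun, Finset.sum_filter, Finset.sum_congr rfl fun σ _ => h σ, sum_perm_succ]
  simp only [removeLargest_insertLargest]
  rw [← Finset.sum_subset (Finset.subset_univ (simsun n))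
    (fun π _ hπ => by simp [hπ])]
  exact Finset.sum_congr rfl fun π hπ => by simp [hπ]

variable {k : Type*} [CommRing k] [Algebra k A]

theorem iterate_derivation_eq_sum_cycleWeight (D : Derivation k A A) {e s p a d : A}
    (he : D e = e * s) (hs : D s = p) (hp : D p = p * (a + d)) (hd : D d = p) (ha : D a = p)
    (n : ℕ) : D^[n] e = e * ∑ π : Equiv.Perm (Fin n), cycleWeight s p a d π := by
  induction n with
  | zero => simp [cycleWeight]
  | succ n ih =>
    rw [Function.iterate_succ_apply', ih, Derivation.leibniz, he, map_sum, sum_perm_succ,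
      Finset.sum_congr rfl fun π _ => derivation_cycleWeight D hs hp hd π (Or.inl ha),
      Finset.sum_add_distrib]
    simp only [cycleWeight_insertLargest_none, smul_eq_mul, ← Finset.mul_sum]
    ring

theorem iterate_derivation_eq_sum_simsun (D : Derivation k A A) {e s p d : A}
    (he : D e = e * s) (hs : D s = p) (hp : D p = p * d) (hd : D d = p)
    (n : ℕ) : D^[n] e = e * ∑ π ∈ simsun n, cycleWeight s p 0 d π := by
  induction n with
  | zero => simp [cycleWeight, simsun]
  | succ n ih =>
    rw [Function.iterate_succ_apply', ih, Derivation.leibniz, he, map_sum, sum_simsun_succ,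
      Finset.sum_congr rfl fun π hπ =>
        derivation_cycleWeight D hs (by rw [hp, zero_add]) hd π
          (Or.inr (cda_eq_zero_of_mem_simsun hπ)),
      Finset.sum_add_distrib]
    simp only [cycleWeight_insertLargest_none, smul_eq_mul, ← Finset.mul_sum]
    ring

end Weight

/-- `π` maps the excedance letters onto the letters with a smaller predecessor. -/
theorem card_symm_lt {n : ℕ} (π : Equiv.Perm (Fin n)) :
    (Finset.univ.filter fun v : Fin n => π.symm v < v).card = exc π := by
  refine (Finset.card_equiv π fun v => ?_).symm
  simp

/-- Without cycle double ascents, the excedance letters are the cycle valleys; they are as numerous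
as the cycle peaks. -/
theorem fixCount_add_two_mul_exc_le {n : ℕ} {π : Equiv.Perm (Fin n)} (h : cda π = 0) :
    fixCount π + 2 * exc π ≤ n := by
  have h0 : ∀ v, ¬ (π.symm v < v ∧ v < π v) := by
    simpa [cda, Finset.filter_eq_empty_iff] using h
  have key : fixCount π + exc π + exc π ≤ Fintype.card (Fin n) := by
    nth_rw 2 [← card_symm_lt]
    rw [exc, fixCount, ← Finset.card_union_of_disjoint, ← Finset.card_union_of_disjoint]
    · exact Finset.card_le_univ _
    · rw [Finset.disjoint_union_left, Finset.disjoint_filter, Finset.disjoint_filter]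
      refine ⟨fun v _ h₁ h₂ => ?_, fun v _ h₁ h₂ => h0 v ⟨h₂, h₁⟩⟩
      rw [(Equiv.symm_apply_eq _).2 h₁.symm] at h₂
      exact lt_irrefl _ h₂
    · rw [Finset.disjoint_filter]
      exact fun v _ h₁ h₂ => h₂.ne' h₁
  rw [Fintype.card_fin] at key
  omega

theorem cycleWeight_zero_one {A : Type*} [CommRing A] (s x : A) {n : ℕ}
    (π : Equiv.Perm (Fin n)) :
    cycleWeight s x 0 1 π = if cda π = 0 then s ^ fixCount π * x ^ exc π else 0 := by
  split_ifs with h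
  · have h0 : ∀ v, ¬ (π.symm v < v ∧ v < π v) := by
      simpa [cda, Finset.filter_eq_empty_iff] using h
    have hv : ∀ v, letterWeight s x 0 1 (π.symm v) v (π v) =
        (if π v = v then s else 1) * if π.symm v < v then x else 1 := by
      intro v
      by_cases h₁ : π v = v
      · have h₂ : π.symm v = v := (Equiv.symm_apply_eq _).2 h₁.symm
        simp [letterWeight, h₁, h₂]
      · by_cases h₂ : π.symm v < v
        · have h₃ : π v < v := lt_of_le_of_ne (not_lt.1 fun h₃ => h0 v ⟨h₂, h₃⟩) h₁
          simp [letterWeight, h₁, h₂, h₃]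
        · simp [letterWeight, h₁, h₂]
    rw [cycleWeight, Finset.prod_congr rfl fun v _ => hv v, Finset.prod_mul_distrib,
      Finset.prod_ite, Finset.prod_ite]
    simp only [Finset.prod_const, one_pow, mul_one, fixCount, card_symm_lt]
  · exact cycleWeight_eq_zero s x 1 h

end PermStat

/-! ### Insertion into the one-line notation -/

namespace PermStat

/-- Insert a new largest letter into the one-line notation of a permutation of `n` letters, so that
it is preceded by exactly `k` letters. -/
def insertAt {n : ℕ} (k : Fin (n + 1)) (π : Equiv.Perm (Fin n)) : Equiv.Perm (Fin (n + 1)) :=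
  (finSuccEquiv' k).trans (π.optionCongr.trans finSuccEquivLast.symm)

theorem insertAt_self {n : ℕ} (k : Fin (n + 1)) (π : Equiv.Perm (Fin n)) :
    insertAt k π k = Fin.last n := by
  simp [insertAt]

theorem insertAt_succAbove {n : ℕ} (k : Fin (n + 1)) (π : Equiv.Perm (Fin n)) (j : Fin n) :
    insertAt k π (k.succAbove j) = (π j).castSucc := by
  simp [insertAt]

theorem insertAt_bijective (n : ℕ) :
    Function.Bijective fun q : Fin (n + 1) × Equiv.Perm (Fin n) => insertAt q.1 q.2 := by
  rw [Fintype.bijective_iff_injective_and_card]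
  constructor
  · rintro ⟨k, π⟩ ⟨l, ρ⟩ h
    replace h : insertAt k π = insertAt l ρ := h
    have hkl : k = l := by
      have h₁ := insertAt_self k π
      rw [h, ← insertAt_self l ρ] at h₁
      exact (insertAt l ρ).injective h₁
    subst hkl
    congr 1
    ext1 j
    have h₂ := insertAt_succAbove k π j
    rw [h, insertAt_succAbove] at h₂
    exact (Fin.castSucc_injective n h₂).symm
  · simp [Fintype.card_perm, Nat.factorial_succ]

theorem sum_perm_succ_insertAt {A : Type*} [AddCommMonoid A] {n : ℕ}
    (f : Equiv.Perm (Fin (n + 1)) → A) :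
    ∑ σ, f σ = ∑ π : Equiv.Perm (Fin n), ∑ k, f (insertAt k π) := by
  rw [← (insertAt_bijective n).sum_comp, Fintype.sum_prod_type_right]

theorem entry_le {n : ℕ} (π : Equiv.Perm (Fin n)) (m : ℕ) : entry π m ≤ n := by
  unfold entry
  split_ifs with h
  · exact (π _).isLt
  · exact n.zero_le

theorem entry_insertAt_of_le {n : ℕ} (k : Fin (n + 1)) (π : Equiv.Perm (Fin n)) {m : ℕ}
    (hm : m ≤ k) : entry (insertAt k π) m = entry π m := by
  have hk := k.isLt
  unfold entry
  by_cases h : 1 ≤ m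
  · rw [dif_pos ⟨h, by omega⟩, dif_pos ⟨h, by omega⟩]
    have : (⟨m - 1, by omega⟩ : Fin (n + 1)) = k.succAbove ⟨m - 1, by omega⟩ := by
      rw [Fin.succAbove_of_castSucc_lt _ _ (by rw [Fin.lt_def]; simp; omega)]
      rfl
    rw [this, insertAt_succAbove]
    rfl
  · rw [dif_neg (by omega), dif_neg (by omega)]

theorem entry_insertAt_self {n : ℕ} (k : Fin (n + 1)) (π : Equiv.Perm (Fin n)) :
    entry (insertAt k π) (k + 1) = n + 1 := by
  have hk := k.isLt
  unfold entry
  rw [dif_pos ⟨by omega, by omega⟩]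
  have : (⟨k + 1 - 1, by omega⟩ : Fin (n + 1)) = k := rfl
  rw [this, insertAt_self]
  rfl

theorem entry_insertAt_of_lt {n : ℕ} (k : Fin (n + 1)) (π : Equiv.Perm (Fin n)) {m : ℕ}
    (hm : (k : ℕ) < m) : entry (insertAt k π) (m + 1) = entry π m := by
  unfold entry
  by_cases h : m ≤ n
  · rw [dif_pos ⟨by omega, by omega⟩, dif_pos ⟨by omega, h⟩]
    have : (⟨m + 1 - 1, by omega⟩ : Fin (n + 1)) = k.succAbove ⟨m - 1, by omega⟩ := by
      rw [Fin.succAbove_of_le_castSucc _ _ (by rw [Fin.le_def]; simp; omega)]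
      ext
      simp
      omega
    rw [this, insertAt_succAbove]
    rfl
  · rw [dif_neg (by omega), dif_neg (by omega)]

/-- The indicator function of the left peaks. -/
def peakInd {n : ℕ} (π : Equiv.Perm (Fin n)) (i : ℕ) : ℕ :=
  if (1 ≤ i ∧ i ≤ n - 1) ∧ entry π (i - 1) < entry π i ∧ entry π (i + 1) < entry π i then 1 else 0

theorem peakInd_eq_zero {n : ℕ} (π : Equiv.Perm (Fin n)) {i : ℕ} (h : ¬ (1 ≤ i ∧ i ≤ n - 1)) :
    peakInd π i = 0 :=
  if_neg fun h' => h h'.1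

theorem peakInd_add_peakInd_succ_le {n : ℕ} (π : Equiv.Perm (Fin n)) (i : ℕ) :
    peakInd π i + peakInd π (i + 1) ≤ 1 := by
  unfold peakInd
  rw [Nat.add_sub_cancel]
  split_ifs <;> omega

theorem sum_peakInd {n N : ℕ} (π : Equiv.Perm (Fin n)) (hN : n ≤ N) :
    ∑ i ∈ Finset.range N, peakInd π i = lpk π := by
  rw [lpk, Finset.card_filter]
  have hsub : Finset.Icc 1 (n - 1) ⊆ Finset.range N := by
    intro i hi
    rw [Finset.mem_Icc] at hi
    rw [Finset.mem_range]
    omega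
  rw [← Finset.sum_subset hsub fun i _ hi => peakInd_eq_zero π (by rwa [Finset.mem_Icc] at hi)]
  refine Finset.sum_congr rfl fun i hi => ?_
  rw [Finset.mem_Icc] at hi
  simp only [peakInd, hi, and_self, true_and]

/-- Inserting the largest letter at position `k + 1` destroys the left peaks at `k` and `k + 1`, and
creates one unless the new letter is the last one. -/
theorem lpk_insertAt {n : ℕ} (k : Fin (n + 1)) (π : Equiv.Perm (Fin n)) :
    lpk (insertAt k π) + (peakInd π k + peakInd π (k + 1)) =
      lpk π + if (k : ℕ) < n then 1 else 0 := by
  have hk := k.isLt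
  have h₁ : ∀ i ∈ Finset.range (k : ℕ), peakInd (insertAt k π) i = peakInd π i := by
    intro i hi
    rw [Finset.mem_range] at hi
    unfold peakInd
    rw [entry_insertAt_of_le k π (by omega), entry_insertAt_of_le k π (by omega),
      entry_insertAt_of_le k π (by omega)]
    refine if_congr (and_congr_left fun _ => ?_) rfl rfl
    omega
  have h₂ : peakInd (insertAt k π) k = 0 := by
    refine if_neg fun h => ?_
    rw [entry_insertAt_self, entry_insertAt_of_le k π le_rfl] at h
    have := entry_le π k
    omega
  have h₃ : peakInd (insertAt k π) (k + 1) = if (k : ℕ) < n then 1 else 0 := by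
    unfold peakInd
    rw [entry_insertAt_self, show (k : ℕ) + 1 - 1 = k from rfl, entry_insertAt_of_le k π le_rfl,
      entry_insertAt_of_lt k π (Nat.lt_add_one _)]
    have := entry_le π k
    have := entry_le π (k + 1)
    refine if_congr ?_ rfl rfl
    omega
  have h₄ : peakInd (insertAt k π) (k + 2) = 0 := by
    refine if_neg fun h => ?_
    rw [show (k : ℕ) + 2 - 1 = k + 1 by omega, entry_insertAt_self] at h
    have := entry_insertAt_of_lt k π (Nat.lt_succ_self k)
    have := entry_le π (k + 1)
    simp only [Nat.succ_eq_add_one, add_assoc, Nat.reduceAdd] at *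
    omega
  have h₅ : ∀ i ∈ Finset.range n,
      peakInd (insertAt k π) (k + 3 + i) = peakInd π (k + 2 + i) := by
    intro i _
    unfold peakInd
    rw [show (k : ℕ) + 3 + i - 1 = k + 1 + i + 1 by omega,
      show (k : ℕ) + 3 + i = k + 2 + i + 1 by omega,
      show (k : ℕ) + 2 + i - 1 = k + 1 + i by omega,
      entry_insertAt_of_lt k π (by omega), entry_insertAt_of_lt k π (by omega),
      entry_insertAt_of_lt k π (by omega)]
    refine if_congr (and_congr_left fun _ => ?_) rfl rfl
    omega
  -- Both sums are padded with zeros and cut into blocks: the positions `k, k + 1, k + 2` after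
  -- insertion face `k, k + 1` before it, and the tails match by a shift.
  rw [← sum_peakInd (insertAt k π) (show n + 1 ≤ k + 3 + n by omega),
    ← sum_peakInd π (show n ≤ k + 2 + n by omega), Finset.sum_range_add _ ((k : ℕ) + 3),
    Finset.sum_range_add _ (k : ℕ) 3, Finset.sum_range_add _ ((k : ℕ) + 2),
    Finset.sum_range_add _ (k : ℕ) 2, Finset.sum_congr rfl h₅, Finset.sum_congr rfl h₁]
  simp only [Finset.sum_range_succ, Finset.sum_range_zero, add_zero, h₂, h₃, h₄]
  ring

/-- A left peak at `i` satisfies `1 ≤ i ≤ n - 1`, so both adjacent slots `i - 1` and `i` are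
counted. -/
theorem sum_peakInd_adjacent {n : ℕ} (π : Equiv.Perm (Fin n)) :
    ∑ k : Fin n, (peakInd π k + peakInd π (k + 1)) = 2 * lpk π := by
  rw [Fin.sum_univ_eq_sum_range (fun k => peakInd π k + peakInd π (k + 1)),
    Finset.sum_add_distrib, sum_peakInd π le_rfl, two_mul]
  congr 1
  have h := Finset.sum_range_succ' (peakInd π) n
  rw [sum_peakInd π n.le_succ, peakInd_eq_zero π (by omega), add_zero] at h
  exact h.symm

theorem two_mul_lpk_le {n : ℕ} (π : Equiv.Perm (Fin n)) : 2 * lpk π ≤ n := by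
  rw [← sum_peakInd_adjacent]
  calc _ ≤ ∑ _k : Fin n, 1 := Finset.sum_le_sum fun k _ => peakInd_add_peakInd_succ_le π k
    _ = n := by simp

section Weight

variable {A : Type*} [CommRing A]

/-- Every left peak has weight `p`; the factor `w` counts the slots of the one-line notation, except
the last one, that are not adjacent to a left peak. -/
def peakWeight (p w : A) {n : ℕ} (π : Equiv.Perm (Fin n)) : A :=
  p ^ lpk π * w ^ (n - 2 * lpk π)

theorem peakWeight_insertAt_last (p w : A) {n : ℕ} (π : Equiv.Perm (Fin n)) :
    peakWeight p w (insertAt (Fin.last n) π) = w * peakWeight p w π := by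
  have h := lpk_insertAt (Fin.last n) π
  rw [peakInd_eq_zero π (by simp; omega), peakInd_eq_zero π (by simp),
    if_neg (by simp)] at h
  have h' : lpk (insertAt (Fin.last n) π) = lpk π := h
  have hle := two_mul_lpk_le π
  rw [peakWeight, peakWeight, h', show n + 1 - 2 * lpk π = n - 2 * lpk π + 1 by omega]
  ring

/-- The sum of the two indicators is `0` or `1` and selects one of two cases: beside a peak, the
peak is merely replaced; elsewhere a new one arises. This form is linear in the indicators, hence
easy to sum over the slots. -/
theorem peakWeight_insertAt_castSucc (p w : A) {n : ℕ} (π : Equiv.Perm (Fin n)) (k : Fin n) :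
    peakWeight p w (insertAt k.castSucc π) =
      ((peakInd π k + peakInd π (k + 1) : ℕ) : A) * (p ^ lpk π * w ^ (n - 2 * lpk π + 1)) +
      (1 - ((peakInd π k + peakInd π (k + 1) : ℕ) : A)) *
        (p ^ (lpk π + 1) * w ^ (n - 2 * lpk π - 1)) := by
  have h := lpk_insertAt k.castSucc π
  rw [if_pos (by simp), Fin.val_castSucc] at h
  have hle := two_mul_lpk_le π
  rcases Nat.le_one_iff_eq_zero_or_eq_one.1 (peakInd_add_peakInd_succ_le π k) with h' | h'
  · rw [h'] at h ⊢
    have h'' : lpk (insertAt k.castSucc π) = lpk π + 1 := h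
    rw [peakWeight, h'', show n + 1 - 2 * (lpk π + 1) = n - 2 * lpk π - 1 by omega]
    simp
  · rw [h'] at h ⊢
    have h'' : lpk (insertAt k.castSucc π) = lpk π := by omega
    rw [peakWeight, h'', show n + 1 - 2 * lpk π = n - 2 * lpk π + 1 by omega]
    simp

variable {k : Type*} [CommRing k] [Algebra k A]

/-- With `l` left peaks, `2l` slots lie beside a peak and yield `p^l w^(n-2l+1)`; the other `n - 2l`
yield `p^(l+1) w^(n-2l-1)`. This is the Leibniz rule for `p^l w^(n-2l)`. -/
theorem derivation_peakWeight (D : Derivation k A A) {p w : A} (hp : D p = 2 * p * w)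
    (hw : D w = p) {n : ℕ} (π : Equiv.Perm (Fin n)) :
    D (peakWeight p w π) = ∑ k : Fin n, peakWeight p w (insertAt k.castSucc π) := by
  simp only [peakWeight_insertAt_castSucc]
  rw [Finset.sum_add_distrib, ← Finset.sum_mul, ← Finset.sum_mul, Finset.sum_sub_distrib,
    ← Nat.cast_sum, sum_peakInd_adjacent]
  simp only [Finset.sum_const, Finset.card_univ, Fintype.card_fin, nsmul_eq_mul, mul_one]
  rw [peakWeight, Derivation.leibniz, Derivation.leibniz_pow, Derivation.leibniz_pow, hp, hw,
    ← Nat.cast_sub (two_mul_lpk_le π)]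
  have hpow : (lpk π : A) * p ^ (lpk π - 1) * p = lpk π * p ^ lpk π := by
    rcases Nat.eq_zero_or_pos (lpk π) with h | h
    · simp [h]
    · rw [mul_assoc, pow_sub_one_mul h.ne']
  simp only [nsmul_eq_mul, smul_eq_mul, Nat.cast_mul, Nat.cast_ofNat]
  linear_combination 2 * w ^ (n - 2 * lpk π + 1) * hpow

theorem iterate_derivation_eq_sum_peakWeight (D : Derivation k A A) {e p w : A}
    (he : D e = e * w) (hp : D p = 2 * p * w) (hw : D w = p) (n : ℕ) :
    D^[n] e = e * ∑ π : Equiv.Perm (Fin n), peakWeight p w π := by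
  induction n with
  | zero => simp [peakWeight, lpk]
  | succ n ih =>
    rw [Function.iterate_succ_apply', ih, Derivation.leibniz, he, map_sum,
      sum_perm_succ_insertAt]
    simp only [Fin.sum_univ_castSucc, peakWeight_insertAt_last, derivation_peakWeight D hp hw,
      smul_eq_mul, Finset.sum_add_distrib, ← Finset.mul_sum]
    ring

end Weight

end PermStat

/-! ### Generating functions and their differential equations -/

namespace PermStat

/-- The truncated ranges lose nothing, because `fixCount π + 2 * exc π ≤ n` on `t`. -/
theorem sum_card_fixCount_exc {R : Type*} [CommRing R] (n : ℕ)
    (t : Finset (Equiv.Perm (Fin n))) (ht : ∀ π ∈ t, cda π = 0)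
    (s x : R) :
    ∑ i ∈ Finset.range (n + 1), ∑ j ∈ Finset.range ((n - i) / 2 + 1),
      ((t.filter fun π => fixCount π = i ∧ exc π = j).card : R) * s ^ i * x ^ j =
      ∑ π ∈ t, s ^ fixCount π * x ^ exc π := by
  have hle : ∀ π ∈ t, fixCount π + 2 * exc π ≤ n := fun π hπ =>
    fixCount_add_two_mul_exc_le (ht π hπ)
  rw [← Finset.sum_fiberwise_of_maps_to (s := t) (t := Finset.range (n + 1)) (g := fixCount)
    (fun π hπ => Finset.mem_range.2 (by have := hle π hπ; omega))]
  refine Finset.sum_congr rfl fun i _ => ?_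
  rw [← Finset.sum_fiberwise_of_maps_to (s := t.filter fun π => fixCount π = i)
    (t := Finset.range ((n - i) / 2 + 1)) (g := exc)
    (fun π hπ => by
      obtain ⟨hπt, rfl⟩ := Finset.mem_filter.1 hπ
      have := hle π hπt
      exact Finset.mem_range.2 (by omega))]
  refine Finset.sum_congr rfl fun j _ => ?_
  rw [Finset.filter_filter, mul_assoc, ← nsmul_eq_mul, ← Finset.sum_const]
  refine Finset.sum_congr rfl fun π hπ => ?_
  obtain ⟨-, rfl, rfl⟩ := Finset.mem_filter.1 hπ
  rfl

theorem sum_lpkNum_eq {R : Type*} [CommRing R] (n : ℕ) (x : R) :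
    ∑ i ∈ Finset.range (n / 2 + 1), 4 ^ i * (lpkNum n i : R) * x ^ i =
      ∑ π : Equiv.Perm (Fin n), (4 * x) ^ lpk π := by
  rw [← Finset.sum_fiberwise_of_maps_to (t := Finset.range (n / 2 + 1)) (g := lpk)
    (fun π _ => Finset.mem_range.2 (by have := two_mul_lpk_le π; omega))]
  refine Finset.sum_congr rfl fun i _ => ?_
  rw [mul_right_comm, ← mul_pow, mul_comm, lpkNum, ← nsmul_eq_mul, ← Finset.sum_const]
  refine Finset.sum_congr rfl fun π hπ => ?_
  rw [(Finset.mem_filter.1 hπ).2]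

theorem sum_cycleWeight_zero_one {R : Type*} [CommRing R] (s x : R) (n : ℕ)
    (t : Finset (Equiv.Perm (Fin n))) :
    ∑ π ∈ t, cycleWeight s x 0 1 π =
      ∑ π ∈ t.filter fun π => cda π = 0, s ^ fixCount π * x ^ exc π := by
  simp only [cycleWeight_zero_one, Finset.sum_filter]

theorem map_cycleWeight {A B : Type*} [CommRing A] [CommRing B] (φ : A →+* B) (s p a d : A)
    {n : ℕ} (π : Equiv.Perm (Fin n)) :
    φ (cycleWeight s p a d π) = cycleWeight (φ s) (φ p) (φ a) (φ d) π := by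
  simp only [cycleWeight, letterWeight, map_prod, apply_ite φ, map_one]

section Series

variable {R : Type*} [CommRing R] [Algebra ℚ R]

open PowerSeries

theorem eq_egf {f : R⟦X⟧} {a : ℕ → R}
    (h : ∀ n, constantCoeff ((derivative R)^[n] f) = a n) : f = egf a := by
  ext n
  rw [egf, coeff_mk, ← h, constantCoeff_iterate_derivative, ← mul_assoc,
    ← map_natCast (algebraMap ℚ R), ← map_mul,
    one_div_mul_cancel (Nat.cast_ne_zero.2 n.factorial_ne_zero), map_one, one_mul]

/-- The weights obey the insertion rules since `x + y + y²` has derivative `(x + y + y²)(y + (1 +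
y))`; at `z = 0` double ascents get weight `0`. -/
theorem eq_cSeries {s x : R} {e y : R⟦X⟧} (hy₀ : constantCoeff y = 0)
    (hy : derivative R y = C x + y + y ^ 2) (he₀ : constantCoeff e = 1)
    (he : derivative R e = e * (C s + y)) : e = cSeries s x := by
  refine eq_egf fun n => ?_
  rw [iterate_derivation_eq_sum_cycleWeight (derivative R) (s := C s + y)
    (p := C x + y + y ^ 2) (a := y) (d := 1 + y) he (by simp [hy])
    (by simp [hy]; ring) (by simp [hy]) hy n]
  rw [map_mul, he₀, one_mul, map_sum]
  simp only [map_cycleWeight, map_add, map_pow, map_one, hy₀, constantCoeff_C, add_zero, ne_eq,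
    OfNat.ofNat_ne_zero, not_false_eq_true, zero_pow]
  rw [sum_cycleWeight_zero_one]
  exact (sum_card_fixCount_exc n (noCda n) (fun π hπ => (Finset.mem_filter.1 hπ).2) s x).symm

theorem eq_mSeries {s x : R} {e y : R⟦X⟧} (hy₀ : constantCoeff y = 0)
    (hy : derivative R y = C x + y + y ^ 2) (he₀ : constantCoeff e = 1)
    (he : derivative R e = e * (C s + 2 * y)) : e = mSeries s (2 * x) := by
  have h2 : derivative R (2 : R⟦X⟧) = 0 := mod_cast (derivative R).map_natCast 2
  have h2y : derivative R (2 * y) = 2 * (C x + y + y ^ 2) := by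
    simp [Derivation.leibniz, h2, hy]
  refine eq_egf fun n => ?_
  rw [iterate_derivation_eq_sum_simsun (derivative R) (s := C s + 2 * y)
    (p := 2 * (C x + y + y ^ 2)) (d := 1 + 2 * y) he (by simp [h2y])
    (by simp [hy, h2, Derivation.leibniz]; ring) (by simp [h2y]) n]
  rw [map_mul, he₀, one_mul, map_sum]
  simp only [map_cycleWeight, map_add, map_mul, map_pow, map_one, hy₀, constantCoeff_C, add_zero,
    ne_eq, OfNat.ofNat_ne_zero, not_false_eq_true, zero_pow, map_ofNat, mul_zero, map_zero]
  rw [sum_cycleWeight_zero_one,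
    Finset.filter_true_of_mem fun π hπ => cda_eq_zero_of_mem_simsun hπ]
  exact (sum_card_fixCount_exc n (simsun n)
    (fun π hπ => cda_eq_zero_of_mem_simsun hπ) s (2 * x)).symm

theorem eq_bSeries {x : R} {e w : R⟦X⟧} (hw₀ : constantCoeff w = 1)
    (hw : derivative R w = C (4 * x - 1) + w ^ 2) (he₀ : constantCoeff e = 1)
    (he : derivative R e = e * w) : e = bSeries x := by
  refine eq_egf fun n => ?_
  rw [iterate_derivation_eq_sum_peakWeight (derivative R) he
    (p := C (4 * x - 1) + w ^ 2) (by simp [hw]; ring) hw n]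
  rw [map_mul, he₀, one_mul, map_sum, sum_lpkNum_eq]
  simp [peakWeight, hw₀]

/-- Solving both equations formally and identifying the solution by `eq_cSeries` gives `cSeries` its
differential equation. -/
theorem exists_cSeries (s x : R) : ∃ y : R⟦X⟧, constantCoeff y = 0 ∧
    derivative R y = C x + y + y ^ 2 ∧ constantCoeff (cSeries s x) = 1 ∧
    derivative R (cSeries s x) = cSeries s x * (C s + y) := by
  obtain ⟨y, hy₀, hy⟩ := exists_derivative_eq (fun y : R⟦X⟧ => C x + y + y ^ 2)
    (fun f g n h => by
      simp only [map_add, sq, coeff_mul_congr h h, h n le_rfl]) 0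
  obtain ⟨e, he₀, he⟩ := exists_derivative_eq (fun e : R⟦X⟧ => e * (C s + y))
    (fun f g n h => coeff_mul_congr h fun _ _ => rfl) 1
  obtain rfl := eq_cSeries hy₀ hy he₀ he
  exact ⟨y, hy₀, hy, he₀, he⟩

theorem two_mul_algebraMap_half : (2 : R) * algebraMap ℚ R (1 / 2) = 1 := by
  rw [← map_ofNat (algebraMap ℚ R) 2, ← map_mul]
  norm_num

theorem rescale_two_cSeries_half (x : R) :
    rescale (2 : R) (cSeries (algebraMap ℚ R (1 / 2)) x) = bSeries x := by
  obtain ⟨y, hy₀, hy, he₀, he⟩ := exists_cSeries (algebraMap ℚ R (1 / 2)) x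
  have h2 : derivative R (2 : R⟦X⟧) = 0 := mod_cast (derivative R).map_natCast 2
  have hC2 : (C (2 : R) : R⟦X⟧) = 2 := map_ofNat C 2
  have hC4 : (C (4 : R) : R⟦X⟧) = 4 := map_ofNat C 4
  have hCr : ∀ a : R, rescale (2 : R) (C a : R⟦X⟧) = C a := fun a => by
    ext n
    rw [coeff_rescale, coeff_C]
    split_ifs with h <;> simp [h]
  have hcr : ∀ f : R⟦X⟧, constantCoeff (rescale (2 : R) f) = constantCoeff f := fun f => by
    rw [← coeff_zero_eq_constantCoeff_apply, coeff_rescale]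
    simp
  -- `w` is the logarithmic derivative `2 (1/2 + y(2z))` of the rescaled series; completing the
  -- square, `4(x + y + y²) = 4x - 1 + (1 + 2y)²`.
  refine eq_bSeries (w := 1 + 2 * rescale (2 : R) y) ?_ ?_ ?_ ?_
  · simp [hcr, hy₀]
  · have : derivative R (rescale (2 : R) y) =
        2 * (C x + rescale (2 : R) y + rescale (2 : R) y ^ 2) := by
      rw [derivative_rescale, hy, map_add, map_add, map_pow, hCr, hC2]
    simp only [map_add, map_sub, map_mul, Derivation.leibniz, h2, this, derivative_one, hC4,
      map_one, smul_eq_mul, mul_zero, add_zero, zero_add]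
    ring
  · rw [hcr, he₀]
  · have h : (2 : R⟦X⟧) * C (algebraMap ℚ R (1 / 2)) = 1 := by
      rw [← hC2, ← map_mul, two_mul_algebraMap_half, map_one]
    rw [derivative_rescale, he, map_mul, map_add, hCr, hC2]
    linear_combination rescale (2 : R) (cSeries (algebraMap ℚ R (1 / 2)) x) * h

theorem cSeries_sq (s x : R) :
    cSeries s x ^ 2 = rescale s (exp R) * mSeries s (2 * x) := by
  obtain ⟨y, hy₀, hy, he₀, he⟩ := exists_cSeries s x
  have hE : rescale s (exp R) * rescale (-s) (exp R) = 1 := by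
    rw [exp_mul_exp_eq_exp_add, add_neg_cancel, rescale_zero_apply, constantCoeff_exp, map_one]
  -- The factor `e^{-sz}` lowers the logarithmic derivative `2s + 2y` to `s + 2y`.
  have hm : rescale (-s) (exp R) * cSeries s x ^ 2 = mSeries s (2 * x) := by
    refine eq_mSeries hy₀ hy ?_ ?_
    · rw [map_mul, map_pow, he₀, ← coeff_zero_eq_constantCoeff_apply, coeff_rescale]
      simp
    · rw [Derivation.leibniz, derivative_pow, he, derivative_rescale, derivative_exp]
      simp only [smul_eq_mul, map_neg]
      push_cast
      ring
  rw [← hm, ← mul_assoc, hE, one_mul]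

theorem egf_injective : Function.Injective (egf : (ℕ → R) → R⟦X⟧) := by
  intro a b h
  ext n
  have hn := congrArg (fun f => (n.factorial : R) * coeff n f) h
  simp only [egf, coeff_mk, ← mul_assoc] at hn
  rwa [← map_natCast (algebraMap ℚ R), ← map_mul,
    mul_one_div_cancel (Nat.cast_ne_zero.2 n.factorial_ne_zero), map_one, one_mul, one_mul] at hn

theorem rescale_egf (c : R) (a : ℕ → R) : rescale c (egf a) = egf fun n => c ^ n * a n := by
  ext n
  simp only [egf, coeff_rescale, coeff_mk]
  ring

theorem sum_noCda_two_pow (x : R) (n : ℕ) :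
    ∑ π ∈ noCda n, (2 : R) ^ (n - fixCount π) * x ^ exc π =
      ∑ π : Equiv.Perm (Fin n), (4 * x) ^ lpk π := by
  have h := rescale_two_cSeries_half x
  rw [cSeries, rescale_egf, bSeries] at h
  have hn := congrFun (egf_injective h) n
  have hc : ∀ π ∈ noCda n, cda π = 0 := fun π hπ => (Finset.mem_filter.1 hπ).2
  simp only [sum_lpkNum_eq] at hn
  rw [← hn]
  have := sum_card_fixCount_exc n (noCda n) hc (algebraMap ℚ R (1 / 2)) x
  simp only [bNum]
  rw [this, Finset.mul_sum]
  refine Finset.sum_congr rfl fun π hπ => ?_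
  have hle := fixCount_add_two_mul_exc_le (hc π hπ)
  rw [← mul_assoc, ← pow_sub_mul_pow (2 : R) (show fixCount π ≤ n by omega), mul_assoc (2 ^ _),
    ← mul_pow, two_mul_algebraMap_half, one_pow, mul_one]

end Series

end PermStat

theorem corollary2p5 {R : Type*} [CommRing R] [Algebra ℚ R] (s x : R) :
    PowerSeries.rescale (2 : R) (PermStat.cSeries (algebraMap ℚ R (1 / 2)) x)
        = PermStat.bSeries x ∧
      PermStat.cSeries s x ^ 2
        = PowerSeries.rescale s (PowerSeries.exp R) * PermStat.mSeries s (2 * x) ∧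
      ∀ n : ℕ,
        ∑ π ∈ PermStat.noCda n, (2 : R) ^ (n - PermStat.fixCount π) * x ^ PermStat.exc π
          = ∑ π : Equiv.Perm (Fin n), (4 * x) ^ PermStat.lpk π :=
  ⟨PermStat.rescale_two_cSeries_half x, PermStat.cSeries_sq s x, PermStat.sum_noCda_two_pow x⟩
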